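/- Let $\mu,\nu$ be probability measures on $\mathbb R$ concentrated on $(-M,0)$ and $(0,M)$ respectively, for some $M>0$, and let $r,t_f>0$ with $r\,t_f>1$. Call a Borel probability measure $\pi(dx,dy,dt)$ on $\mathbb R\times\mathbb R\times[0,t_f]$ admissible if its $x$-marginal is $\mu$, its $y$-marginal is $\nu$, and its $t$-marginal satisfies $\iint_{x,y}\pi(dx,dy,dt)\le r\,dt$. Then there is exactly one minimizer $\pi$ of \[ \iiint_{x,y,t}\left(\frac{x^2}{t}+\frac{y^2}{t_f-t}\right)\pi(dx,dy,dt)\in[0,\infty] \] over the admissible measures (with $a/0=+\infty$ for $a>0$). Moreover, there are non-increasing functions $T^x,T^y:[0,t_f]\to\mathbb R$ and a measurable function $\sigma:[0,t_f]\to[0,r]$ such that $\pi=(T^x,T^y,\mathrm{Id})_\sharp\,(\sigma(t)\,dt)$, where $\mathrm{Id}(t)=t$; that is, $\pi$ is the push-forward of the absolutely continuous measure $\sigma(t)\,dt$ on $[0,t_f]$ under $t\mapsto(T^x(t),T^y(t),t)$. -/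

import Mathlib

open MeasureTheory Set
open scoped ENNReal

noncomputable section

namespace TollTransport

/-- The transport cost `∭ (x² / t + y² / (t_f - t)) π(dx, dy, dt)`, with values in `[0, ∞]`. Points of
`ℝ × ℝ × ℝ` are `(x, y, t)`. The quotients are taken in `[0, ∞]`, so that `x² / 0 = ∞` for `x ≠ 0`:
covering a positive distance in no time has infinite cost. Only times `t ∈ [0, t_f]` matter, since
admissible couplings give no mass to other times. -/
def cost (tf : ℝ) (π : Measure (ℝ × ℝ × ℝ)) : ℝ≥0∞ :=
  ∫⁻ p, (ENNReal.ofReal (p.1 ^ 2) / ENNReal.ofReal p.2.2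
    + ENNReal.ofReal (p.2.1 ^ 2) / ENNReal.ofReal (tf - p.2.2)) ∂π

/-- Admissible couplings: probability measures `π(dx, dy, dt)` with `t ∈ [0, t_f]`, first marginal `μ`,
second marginal `ν`, whose time marginal is at most `r dt` on `[0, t_f]` (and vanishes elsewhere). -/
structure IsAdmissible (μ ν : Measure ℝ) (r tf : ℝ) (π : Measure (ℝ × ℝ × ℝ)) : Prop where
  isProbabilityMeasure : IsProbabilityMeasure π
  map_x : π.map (fun p => p.1) = μ
  map_y : π.map (fun p => p.2.1) = ν
  map_t_le : π.map (fun p => p.2.2) ≤ ENNReal.ofReal r • volume.restrict (Icc 0 tf)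

/-- `π` is an optimal coupling: it is admissible and no admissible coupling has a smaller cost. -/
def IsMinimizer (μ ν : Measure ℝ) (r tf : ℝ) (π : Measure (ℝ × ℝ × ℝ)) : Prop :=
  IsAdmissible μ ν r tf π ∧ ∀ π', IsAdmissible μ ν r tf π' → cost tf π ≤ cost tf π'

end TollTransport

end

namespace TollTransport

open Filter Topology ProbabilityTheory

/-! For a fixed time marginal ρ the cost splits into a term in (x, t) and a term in (y, t). The
function a²/t is a constant multiple of a² plus a positive superposition of indicators of quadrants
{s < a, t < τ}. Among couplings with given marginals, the monotone one charges every such quadrant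
least. Hence the best coupling makes |x| nondecreasing and y nonincreasing in t, so x and y are both
nonincreasing functions of t (`lintegral_sq_div_le`, `IsAdmissible.energy_le_cost`). Since ρ has no
atoms, equality at finite cost forces this graph (`ae_eq_of_lintegral_sq_div_le`,
`IsAdmissible.eq_map_timeMarginal`).

It remains to choose ρ. Through its quantile function, ρ ≤ r dt becomes a lower bound 1/r on the
slope, so the candidates ("schedules") form a convex set. The cost is then an integral strongly
convex in the schedule, with weight x² + y², nonzero a.e. because μ does not charge 0. The midpoint
inequality `energy_midpoint_add_le` gives uniqueness, and makes fast minimizing sequences converge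
a.e., whence existence by Fatou (`exists_energy_minimal`). The condition r tf > 1 provides a
schedule of finite energy. -/

/-- The lower quantile function of a measure `m` carried by `[a, b]`, with values in `[a, b]`. -/
noncomputable def quantile (a b : ℝ) (m : Measure ℝ) (u : ℝ) : ℝ :=
  sInf {x | x ∈ Icc a b ∧ u ≤ cdf m x}

lemma quantile_set_bddBelow {a b : ℝ} {m : Measure ℝ} (u : ℝ) :
    BddBelow {x | x ∈ Icc a b ∧ u ≤ cdf m x} :=
  ⟨a, fun _ hx => hx.1.1⟩

/-! ### Quantile functions and the measures they push forward to. -/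

section Quantile

variable {a b : ℝ} {m : Measure ℝ} [IsProbabilityMeasure m]

lemma le_of_measure_compl_Icc (hm : m (Icc a b)ᶜ = 0) : a ≤ b := by
  by_contra h
  rw [Icc_eq_empty h, compl_empty] at hm
  simp at hm

lemma cdf_eq_one_of_le (hm : m (Icc a b)ᶜ = 0) {x : ℝ} (hx : b ≤ x) : cdf m x = 1 := by
  rw [cdf_eq_real, measureReal_def]
  have : m (Iic x) = 1 := by
    rw [prob_compl_eq_zero_iff measurableSet_Icc] at hm
    refine le_antisymm prob_le_one (hm ▸ measure_mono fun y hy => hy.2.trans hx)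
  simp [this]

lemma cdf_eq_zero_of_lt (hm : m (Icc a b)ᶜ = 0) {x : ℝ} (hx : x < a) : cdf m x = 0 := by
  rw [cdf_eq_real, measureReal_def]
  have : m (Iic x) = 0 := by
    refine measure_mono_null (fun y hy => ?_) hm
    exact fun h => absurd (h.1.trans hy) (not_le.2 hx)
  simp [this]

lemma quantile_set_nonempty (hm : m (Icc a b)ᶜ = 0) {u : ℝ} (hu : u ≤ 1) :
    {x | x ∈ Icc a b ∧ u ≤ cdf m x}.Nonempty :=
  ⟨b, right_mem_Icc.2 (le_of_measure_compl_Icc hm), by rwa [cdf_eq_one_of_le hm le_rfl]⟩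

lemma quantile_mem_Icc (hm : m (Icc a b)ᶜ = 0) {u : ℝ} (hu : u ≤ 1) :
    quantile a b m u ∈ Icc a b := by
  obtain ⟨x, hx⟩ := quantile_set_nonempty hm hu
  exact ⟨le_csInf ⟨x, hx⟩ fun y hy => hy.1.1, (csInf_le (quantile_set_bddBelow u) hx).trans hx.1.2⟩

lemma quantile_monotoneOn (hm : m (Icc a b)ᶜ = 0) : MonotoneOn (quantile a b m) (Iic 1) :=
  fun _ _ _ hv huv => csInf_le_csInf (quantile_set_bddBelow _) (quantile_set_nonempty hm hv)
    fun _ hx => ⟨hx.1, huv.trans hx.2⟩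

lemma le_cdf_quantile (hm : m (Icc a b)ᶜ = 0) {u : ℝ} (hu : u ≤ 1) :
    u ≤ cdf m (quantile a b m u) := by
  have hr : ContinuousWithinAt (cdf m) (Ioi (quantile a b m u)) (quantile a b m u) :=
    ((cdf m).right_continuous _).mono Ioi_subset_Ici_self
  refine ge_of_tendsto hr ?_
  filter_upwards [self_mem_nhdsWithin] with y hy
  obtain ⟨x, hx, hxy⟩ := exists_lt_of_csInf_lt (quantile_set_nonempty hm hu) hy
  exact hx.2.trans (monotone_cdf m hxy.le)

/-- The Galois connection between quantile and cdf. Positivity of `u` rules out points left of `a`,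
where the cdf vanishes. -/
lemma quantile_le_iff (hm : m (Icc a b)ᶜ = 0) {u : ℝ} (hu0 : 0 < u) (hu : u ≤ 1) (x : ℝ) :
    quantile a b m u ≤ x ↔ u ≤ cdf m x := by
  refine ⟨fun h => (le_cdf_quantile hm hu).trans (monotone_cdf m h), fun h => ?_⟩
  rcases le_or_gt b x with hbx | hbx
  · exact (quantile_mem_Icc hm hu).2.trans hbx
  rcases lt_or_ge x a with hxa | hxa
  · rw [cdf_eq_zero_of_lt hm hxa] at h
    exact absurd h (not_le.2 hu0)
  · exact csInf_le (quantile_set_bddBelow u) ⟨⟨hxa, hbx.le⟩, h⟩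

lemma cdf_quantile (hm : m (Icc a b)ᶜ = 0) (hc : Continuous (cdf m)) {u : ℝ} (hu0 : 0 < u)
    (hu : u ≤ 1) : cdf m (quantile a b m u) = u := by
  refine le_antisymm ?_ (le_cdf_quantile hm hu)
  have hl : Tendsto (cdf m) (𝓝[<] (quantile a b m u)) (𝓝 (cdf m (quantile a b m u))) :=
    hc.continuousAt.continuousWithinAt
  refine le_of_tendsto hl ?_
  filter_upwards [self_mem_nhdsWithin] with y hy
  by_contra! h
  exact absurd ((quantile_le_iff hm hu0 hu y).2 h.le) (not_le.2 hy)

/-- Lebesgue measure on the open unit interval. -/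
noncomputable def unitVolume : Measure ℝ := volume.restrict (Ioo 0 1)

instance : IsProbabilityMeasure unitVolume := ⟨by simp [unitVolume]⟩

lemma ae_unitVolume : ∀ᵐ u ∂unitVolume, u ∈ Ioo (0 : ℝ) 1 := ae_restrict_mem measurableSet_Ioo

lemma aemeasurable_quantile (hm : m (Icc a b)ᶜ = 0) : AEMeasurable (quantile a b m) unitVolume :=
  aemeasurable_restrict_of_monotoneOn measurableSet_Ioo
    ((quantile_monotoneOn hm).mono fun _ h => h.2.le)

lemma map_quantile (hm : m (Icc a b)ᶜ = 0) : unitVolume.map (quantile a b m) = m := by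
  have := Measure.isProbabilityMeasure_map (aemeasurable_quantile hm)
  refine Measure.ext_of_Iic _ _ fun x => ?_
  rw [Measure.map_apply_of_aemeasurable (aemeasurable_quantile hm) measurableSet_Iic,
    ← ofReal_cdf m x]
  have h1 : quantile a b m ⁻¹' Iic x =ᵐ[unitVolume] Iic (cdf m x) := by
    filter_upwards [ae_unitVolume] with u hu
    exact propext (quantile_le_iff hm hu.1 hu.2.le x)
  have h0 := cdf_nonneg m x
  have h2 := cdf_le_one m x
  -- With the endpoint removed, the trace on (0, 1) is an open interval even when the cdf equals 1.
  have h3 : Iic (cdf m x) =ᵐ[unitVolume] Iio (cdf m x) := by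
    unfold unitVolume
    exact Iio_ae_eq_Iic.symm
  rw [measure_congr h1, measure_congr h3, unitVolume, Measure.restrict_apply measurableSet_Iio]
  have : Iio (cdf m x) ∩ Ioo 0 1 = Ioo 0 (cdf m x) := by
    ext u; simp only [mem_inter_iff, mem_Iio, mem_Ioo]
    exact ⟨fun h => ⟨h.2.1, h.1⟩, fun h => ⟨h.2, h.1, h.2.trans_le h2⟩⟩
  simp [this]

lemma measurePreserving_one_sub :
    MeasurePreserving (fun u : ℝ => 1 - u) unitVolume unitVolume := by
  have := (Measure.measurePreserving_sub_left (volume : Measure ℝ) 1).restrict_preimage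
    (measurableSet_Ioo (a := (0 : ℝ)) (b := 1))
  simpa [unitVolume] using this

lemma aemeasurable_quantile_one_sub (hm : m (Icc a b)ᶜ = 0) :
    AEMeasurable (fun u => quantile a b m (1 - u)) unitVolume :=
  (aemeasurable_quantile hm).comp_quasiMeasurePreserving
    measurePreserving_one_sub.quasiMeasurePreserving

lemma map_quantile_one_sub (hm : m (Icc a b)ᶜ = 0) :
    unitVolume.map (fun u => quantile a b m (1 - u)) = m := by
  have h := measurePreserving_one_sub
  conv_rhs => rw [← map_quantile hm, ← h.map_eq]
  exact (AEMeasurable.map_map_of_aemeasurable (h.map_eq.symm ▸ aemeasurable_quantile hm)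
    h.aemeasurable).symm

end Quantile

/-! ### Rearrangement inequality for a²/t, with its equality case. -/

section Rearrangement

/-- The measure `2 s ds` on `(0, ∞)`, which gives `(0, a)` the mass `a ^ 2`. -/
noncomputable def squareMeasure : Measure ℝ :=
  (volume.restrict (Ioi 0)).withDensity fun s => ENNReal.ofReal (2 * s)

/-- The measure `τ⁻² dτ` on `(0, c)`, which gives `(t, c)` the mass `t⁻¹ - c⁻¹`. -/
noncomputable def invMeasure (c : ℝ) : Measure ℝ :=
  (volume.restrict (Ioo 0 c)).withDensity fun s => ENNReal.ofReal ((s ^ 2)⁻¹)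

instance : SFinite squareMeasure := by unfold squareMeasure; infer_instance
instance (c : ℝ) : SFinite (invMeasure c) := by unfold invMeasure; infer_instance

lemma squareMeasure_Iio {a : ℝ} (ha : 0 ≤ a) : squareMeasure (Iio a) = ENNReal.ofReal (a ^ 2) := by
  rw [squareMeasure, withDensity_apply _ measurableSet_Iio,
    Measure.restrict_restrict measurableSet_Iio, inter_comm, Ioi_inter_Iio,
    Measure.restrict_congr_set Ioo_ae_eq_Ioc, ← ofReal_integral_eq_lintegral_ofReal,
    ← intervalIntegral.integral_of_le ha]
  · congr 1
    rw [intervalIntegral.integral_const_mul, integral_id]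
    ring
  · exact (Continuous.integrableOn_Icc (by fun_prop)).mono_set Ioc_subset_Icc_self
  · filter_upwards [ae_restrict_mem measurableSet_Ioc] with s hs
    have := hs.1.le
    simp only [Pi.zero_apply]; positivity

lemma invMeasure_Ioi {t c : ℝ} (ht : 0 < t) (htc : t ≤ c) :
    invMeasure c (Ioi t) = ENNReal.ofReal (t⁻¹ - c⁻¹) := by
  have hI : Ioi t ∩ Ioo 0 c = Ioo t c := by
    ext u; simp only [mem_inter_iff, mem_Ioi, mem_Ioo]
    exact ⟨fun h => ⟨h.1, h.2.2⟩, fun h => ⟨h.1, ht.trans h.1, h.2⟩⟩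
  have hpos : ∀ s ∈ uIcc t c, s ≠ 0 := fun s hs => by
    rw [uIcc_of_le htc] at hs
    exact (ht.trans_le hs.1).ne'
  have hcont : ContinuousOn (fun s : ℝ => (s ^ 2)⁻¹) (uIcc t c) :=
    ContinuousOn.inv₀ (by fun_prop) fun s hs => pow_ne_zero 2 (hpos s hs)
  rw [invMeasure, withDensity_apply _ measurableSet_Ioi,
    Measure.restrict_restrict measurableSet_Ioi, hI,
    Measure.restrict_congr_set Ioo_ae_eq_Ioc, ← ofReal_integral_eq_lintegral_ofReal,
    ← intervalIntegral.integral_of_le htc]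
  · congr 1
    rw [intervalIntegral.integral_eq_sub_of_hasDerivAt (f := fun s => -s⁻¹)]
    · ring
    · intro s hs
      simpa using (hasDerivAt_inv (hpos s hs)).fun_neg
    · exact hcont.intervalIntegrable
  · exact (hcont.intervalIntegrable).1
  · filter_upwards with s
    simp only [Pi.zero_apply]; positivity

/-- Layer-cake form of 1/t = 1/c + (1/t - 1/c): the second part is the product mass of a quadrant,
and the first depends on `a` alone. -/
lemma sq_div_eq_add {a t c : ℝ} (ha : 0 ≤ a) (ht : 0 < t) (htc : t ≤ c) :
    ENNReal.ofReal (a ^ 2) / ENNReal.ofReal t = ENNReal.ofReal (a ^ 2) / ENNReal.ofReal c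
      + squareMeasure (Iio a) * invMeasure c (Ioi t) := by
  have hc := ht.trans_le htc
  have h1 : c⁻¹ ≤ t⁻¹ := inv_anti₀ ht htc
  have h2 : 0 ≤ c⁻¹ := by positivity
  rw [squareMeasure_Iio ha, invMeasure_Ioi ht htc, div_eq_mul_inv, div_eq_mul_inv,
    ← ENNReal.ofReal_inv_of_pos ht, ← ENNReal.ofReal_inv_of_pos hc, ← mul_add,
    ← ENNReal.ofReal_add h2 (by linarith)]
  congr 2; ring

variable {Ω : Type*} [MeasurableSpace Ω] {P : Measure Ω}

lemma ae_nonneg_congr {A A' : Ω → ℝ} (hA : Measurable A) (hA' : Measurable A')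
    (hlaw : P.map A = P.map A') (h : ∀ᵐ ω ∂P, 0 ≤ A ω) : ∀ᵐ ω ∂P, 0 ≤ A' ω := by
  have h1 := (ae_map_iff hA.aemeasurable measurableSet_Ici).2 h
  rw [hlaw] at h1
  exact (ae_map_iff hA'.aemeasurable measurableSet_Ici).1 h1

/-- If the quadrants `{A > s, T < τ}` are charged as little as possible at level `s`, then
`A > s ≥ A'` almost never happens. -/
lemma measure_lt_and_le_eq_zero {A A' T : Ω → ℝ} {c : ℝ}
    (hmono : ∀ ω ω', T ω ≤ T ω' → A' ω ≤ A' ω') (hTc : ∀ᵐ ω ∂P, T ω ∈ Ioo 0 c)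
    (hatom : ∀ t, P {ω | T ω = t} = 0) {s : ℝ}
    (hs : ∀ᵐ τ, τ ∈ Ioo 0 c → P {ω | s < A ω ∧ T ω < τ} ≤ P {ω | s < A' ω ∧ T ω < τ}) :
    P {ω | s < A ω ∧ A' ω ≤ s} = 0 := by
  obtain ⟨D, hD, hDc, hDd⟩ := (Measure.dense_of_ae hs).exists_countable_dense_subset
  set N := {ω | A' ω ≤ s}
  -- Points of `N` at its last time. `T` is constant here, so absence of atoms makes this set null.
  set E := {ω | A' ω ≤ s ∧ ∀ ω', A' ω' ≤ s → T ω' ≤ T ω}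
  -- For these `τ` the quadrant of `A'` is empty, so that of `A` is null; countably many cover the
  -- rest of `N`.
  set D' := {τ | τ ∈ D ∧ τ ∈ Ioo 0 c ∧ {ω | T ω < τ} ⊆ N}
  have hE : P E = 0 := by
    rcases E.eq_empty_or_nonempty with h | ⟨ω₀, h₀⟩
    · simp [h]
    · exact measure_mono_null (fun ω hω => le_antisymm (h₀.2 _ hω.1) (hω.2 _ h₀.1)) (hatom (T ω₀))
  have hU : P (⋃ τ ∈ D', {ω | s < A ω ∧ T ω < τ}) = 0 := by
    refine (measure_biUnion_null_iff (hDc.mono fun _ h => h.1)).2 fun τ hτ => ?_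
    refine le_antisymm ((hD hτ.1 hτ.2.1).trans ?_) zero_le
    have : {ω | s < A' ω ∧ T ω < τ} = ∅ :=
      eq_empty_of_forall_notMem fun ω hω => absurd (hτ.2.2 hω.2) (not_le.2 hω.1)
    simp [this]
  have hO : P {ω | T ω ∉ Ioo 0 c} = 0 := hTc
  refine measure_mono_null (fun ω hω => ?_) (measure_union_null (measure_union_null hU hE) hO)
  by_cases hc : T ω ∈ Ioo 0 c
  · left
    by_cases hωE : ω ∈ E
    · exact Or.inr hωE
    · left
      have : ∃ ω', A' ω' ≤ s ∧ T ω < T ω' := by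
        by_contra! h
        exact hωE ⟨hω.2, h⟩
      obtain ⟨ω', h1, h2⟩ := this
      obtain ⟨τ, hτ, hτ1, hτ2⟩ := hDd.exists_between (lt_min h2 hc.2)
      refine mem_iUnion₂.2 ⟨τ, ⟨hτ, ⟨hc.1.trans hτ1, hτ2.trans_le (min_le_right _ _)⟩, ?_⟩, hω.1, hτ1⟩
      intro x hx
      exact (hmono _ _ ((le_of_lt hx).trans (hτ2.le.trans (min_le_left _ _)))).trans h1
  · exact Or.inr hc

variable [IsProbabilityMeasure P]

/-- Tonelli, applied to the set of pairs of a sample point and a quadrant containing it. -/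
lemma lintegral_squareMeasure_mul_invMeasure {A T : Ω → ℝ} (hA : Measurable A) (hT : Measurable T)
    (c : ℝ) :
    ∫⁻ ω, squareMeasure (Iio (A ω)) * invMeasure c (Ioi (T ω)) ∂P
      = ∫⁻ z, P {ω | z.1 < A ω ∧ T ω < z.2} ∂(squareMeasure.prod (invMeasure c)) := by
  have hS : MeasurableSet {q : Ω × (ℝ × ℝ) | q.2.1 < A q.1 ∧ T q.1 < q.2.2} := by
    refine MeasurableSet.inter (s₁ := {q : Ω × (ℝ × ℝ) | q.2.1 < A q.1}) (s₂ := {q : Ω × (ℝ × ℝ) | T q.1 < q.2.2}) ?_ ?_ <;>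
    exact measurableSet_lt (by fun_prop) (by fun_prop)
  have h1 := Measure.prod_apply (μ := P) (ν := squareMeasure.prod (invMeasure c)) hS
  have h2 := Measure.prod_apply_symm (μ := P) (ν := squareMeasure.prod (invMeasure c)) hS
  rw [h1] at h2
  refine Eq.trans (lintegral_congr fun ω => ?_) h2
  rw [← Measure.prod_prod]
  rfl

lemma measurable_measure_lt_and_lt {A T : Ω → ℝ} (hA : Measurable A) (hT : Measurable T) :
    Measurable fun z : ℝ × ℝ => P {ω | z.1 < A ω ∧ T ω < z.2} := by
  have hS : MeasurableSet {q : (ℝ × ℝ) × Ω | q.1.1 < A q.2 ∧ T q.2 < q.1.2} := by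
    refine MeasurableSet.inter (s₁ := {q : (ℝ × ℝ) × Ω | q.1.1 < A q.2}) (s₂ := {q : (ℝ × ℝ) × Ω | T q.2 < q.1.2}) ?_ ?_ <;>
    exact measurableSet_lt (by fun_prop) (by fun_prop)
  exact measurable_measure_prodMk_left hS

/-- Among the random variables with a given law, a monotone function of `T` charges the quadrants
`{A > s, T < τ}` least. -/
lemma measure_lt_and_lt_le {A A' T : Ω → ℝ} (hA : Measurable A) (hA' : Measurable A')
    (hT : Measurable T) (hlaw : P.map A = P.map A')
    (hmono : ∀ ω ω', T ω ≤ T ω' → A' ω ≤ A' ω') (s τ : ℝ) :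
    P {ω | s < A' ω ∧ T ω < τ} ≤ P {ω | s < A ω ∧ T ω < τ} := by
  rcases eq_empty_or_nonempty {ω | s < A' ω ∧ T ω < τ} with he | ⟨ω₀, h1, h2⟩
  · simp [he]
  have hL : MeasurableSet {ω | T ω < τ} := measurableSet_lt hT measurable_const
  -- Once the quadrant of `A'` is nonempty, monotonicity makes the two events cover everything, so
  -- inclusion–exclusion gives the smallest possible intersection.
  have hunion : {ω | s < A' ω} ∪ {ω | T ω < τ} = univ := by
    refine eq_univ_of_forall fun ω => ?_
    rcases lt_or_ge (T ω) τ with h | h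
    · exact Or.inr h
    · exact Or.inl (h1.trans_le (hmono _ _ (h2.le.trans h)))
  have hlawS : P {ω | s < A ω} = P {ω | s < A' ω} := by
    have := congrArg (fun m => m (Ioi s)) hlaw
    simp only [Measure.map_apply hA measurableSet_Ioi, Measure.map_apply hA' measurableSet_Ioi]
      at this
    exact this
  have e1 := measure_union_add_inter (μ := P) {ω | s < A ω} hL
  have e2 := measure_union_add_inter (μ := P) {ω | s < A' ω} hL
  rw [hunion, measure_univ] at e2
  rw [hlawS, ← e2] at e1
  have h3 : P ({ω | s < A ω} ∪ {ω | T ω < τ}) ≤ 1 := prob_le_one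
  have h4 : 1 + P ({ω | s < A' ω} ∩ {ω | T ω < τ}) ≤ 1 + P ({ω | s < A ω} ∩ {ω | T ω < τ}) := by
    rw [← e1]; gcongr
  exact (ENNReal.add_le_add_iff_left ENNReal.one_ne_top).1 h4

lemma lintegral_sq_div_eq {A T : Ω → ℝ} (hA : Measurable A) (hT : Measurable T) {c : ℝ}
    (hA0 : ∀ᵐ ω ∂P, 0 ≤ A ω) (hTc : ∀ᵐ ω ∂P, T ω ∈ Ioo 0 c) :
    ∫⁻ ω, ENNReal.ofReal (A ω ^ 2) / ENNReal.ofReal (T ω) ∂P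
      = ∫⁻ x, ENNReal.ofReal (x ^ 2) / ENNReal.ofReal c ∂(P.map A)
        + ∫⁻ z, P {ω | z.1 < A ω ∧ T ω < z.2} ∂(squareMeasure.prod (invMeasure c)) := by
  rw [lintegral_map (by fun_prop) hA, ← lintegral_squareMeasure_mul_invMeasure hA hT,
    ← lintegral_add_left (by fun_prop)]
  refine lintegral_congr_ae ?_
  filter_upwards [hA0, hTc] with ω h0 h1
  exact sq_div_eq_add h0 h1.1 h1.2.le

/-- The rearrangement inequality for the cost `a ^ 2 / t`. -/
lemma lintegral_sq_div_le {A A' T : Ω → ℝ} (hA : Measurable A) (hA' : Measurable A')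
    (hT : Measurable T) {c : ℝ} (hlaw : P.map A = P.map A')
    (hmono : ∀ ω ω', T ω ≤ T ω' → A' ω ≤ A' ω')
    (hA0 : ∀ᵐ ω ∂P, 0 ≤ A ω) (hTc : ∀ᵐ ω ∂P, T ω ∈ Ioo 0 c) :
    ∫⁻ ω, ENNReal.ofReal (A' ω ^ 2) / ENNReal.ofReal (T ω) ∂P
      ≤ ∫⁻ ω, ENNReal.ofReal (A ω ^ 2) / ENNReal.ofReal (T ω) ∂P := by
  rw [lintegral_sq_div_eq hA hT hA0 hTc,
    lintegral_sq_div_eq hA' hT (ae_nonneg_congr hA hA' hlaw hA0) hTc, hlaw]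
  refine add_le_add_right (lintegral_mono fun z => ?_) _
  exact measure_lt_and_lt_le hA hA' hT hlaw hmono _ _

/-- The density is positive on (0, c), so null sets there are Lebesgue null. -/
lemma ae_pos_of_ae_invMeasure {c : ℝ} {p : ℝ → Prop} (h : ∀ᵐ τ ∂(invMeasure c), p τ) :
    ∀ᵐ τ, τ ∈ Ioo 0 c → p τ := by
  rw [invMeasure, ae_withDensity_iff (by fun_prop), ae_restrict_iff' measurableSet_Ioo] at h
  filter_upwards [h] with τ hτ h1
  refine hτ h1 ?_
  have := h1.1
  simpa using this.ne'

lemma ae_pos_of_ae_squareMeasure {p : ℝ → Prop} (h : ∀ᵐ s ∂squareMeasure, p s) :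
    ∀ᵐ s, 0 < s → p s := by
  rw [squareMeasure, ae_withDensity_iff (by fun_prop), ae_restrict_iff' measurableSet_Ioi] at h
  filter_upwards [h] with s hs h1
  refine hs h1 ?_
  simpa using h1

/-- The equality case of the rearrangement inequality for the cost `a ^ 2 / t`. -/
lemma ae_eq_of_lintegral_sq_div_le {A A' T : Ω → ℝ} (hA : Measurable A) (hA' : Measurable A')
    (hT : Measurable T) {c : ℝ} (hlaw : P.map A = P.map A')
    (hmono : ∀ ω ω', T ω ≤ T ω' → A' ω ≤ A' ω')
    (hA0 : ∀ᵐ ω ∂P, 0 ≤ A ω) (hTc : ∀ᵐ ω ∂P, T ω ∈ Ioo 0 c)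
    (hatom : ∀ t, P {ω | T ω = t} = 0)
    (hfin : ∫⁻ ω, ENNReal.ofReal (A' ω ^ 2) / ENNReal.ofReal (T ω) ∂P ≠ ∞)
    (hle : ∫⁻ ω, ENNReal.ofReal (A ω ^ 2) / ENNReal.ofReal (T ω) ∂P
      ≤ ∫⁻ ω, ENNReal.ofReal (A' ω ^ 2) / ENNReal.ofReal (T ω) ∂P) : A =ᵐ[P] A' := by
  have hA0' := ae_nonneg_congr hA hA' hlaw hA0
  have hfin' := hfin
  have hle' := hle
  rw [lintegral_sq_div_eq hA hT hA0 hTc, lintegral_sq_div_eq hA' hT hA0' hTc, hlaw] at hle'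
  rw [lintegral_sq_div_eq hA' hT hA0' hTc] at hfin'
  obtain ⟨hf1, hf2⟩ := ENNReal.add_ne_top.1 hfin'
  have hae := ae_eq_of_ae_le_of_lintegral_le
    (Eventually.of_forall fun z : ℝ × ℝ => measure_lt_and_lt_le hA hA' hT hlaw hmono z.1 z.2)
    hf2 (measurable_measure_lt_and_lt hA hT).aemeasurable
    ((ENNReal.add_le_add_iff_left hf1).1 hle')
  have h1 : ∀ᵐ s : ℝ, 0 < s → P {ω | s < A ω ∧ A' ω ≤ s} = 0 := by
    filter_upwards [ae_pos_of_ae_squareMeasure (Measure.ae_ae_of_ae_prod hae)] with s hs h0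
    refine measure_lt_and_le_eq_zero (c := c) hmono hTc hatom ?_
    filter_upwards [ae_pos_of_ae_invMeasure (hs h0)] with τ hτ h2
    exact (hτ h2).ge
  obtain ⟨D, hD, hDc, hDd⟩ := (Measure.dense_of_ae h1).exists_countable_dense_subset
  have h2 : ∀ᵐ ω ∂P, ∀ s ∈ D, 0 < s → ¬ (s < A ω ∧ A' ω ≤ s) := by
    rw [ae_ball_iff hDc]
    intro s hs
    by_cases h0 : 0 < s
    · filter_upwards [measure_eq_zero_iff_ae_notMem.1 (hD hs h0)] with ω hω _
      exact hω
    · exact Eventually.of_forall fun _ h => absurd h h0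
  have h3 : ∀ᵐ ω ∂P, A ω ≤ A' ω := by
    filter_upwards [h2, hA0'] with ω h h0
    by_contra! hlt
    obtain ⟨s, hs, hs1, hs2⟩ := hDd.exists_between hlt
    exact h s hs (h0.trans_lt hs1) ⟨hs2, hs1.le⟩
  -- The quadrants only gave `A ≤ A'`. The integrands are then ordered while their integrals are
  -- equal and finite, so they agree a.e.
  have h4 : (fun ω => ENNReal.ofReal (A ω ^ 2) / ENNReal.ofReal (T ω))
      =ᵐ[P] fun ω => ENNReal.ofReal (A' ω ^ 2) / ENNReal.ofReal (T ω) := by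
    refine ae_eq_of_ae_le_of_lintegral_le ?_ (hle.trans_lt hfin.lt_top).ne
      (by fun_prop) (lintegral_sq_div_le hA hA' hT hlaw hmono hA0 hTc)
    filter_upwards [h3, hA0] with ω h h0
    gcongr
  filter_upwards [h4, hA0, hA0', hTc] with ω h h0 h0' hc
  rw [div_eq_mul_inv, div_eq_mul_inv,
    ENNReal.mul_left_inj (by simp) (by simpa using hc.1),
    ENNReal.ofReal_eq_ofReal_iff (by positivity) (by positivity)] at h
  exact (pow_left_inj₀ h0 h0' two_ne_zero).1 h

end Rearrangement

/-! ### Schedules: convexity, uniqueness and existence of the minimizer. -/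

section Schedule

/-- The cost of travelling from `x` to `y` through the origin, crossing it at time `p`. -/
noncomputable def crossingCost (tf x y p : ℝ) : ℝ≥0∞ :=
  ENNReal.ofReal (x ^ 2) / ENNReal.ofReal p + ENNReal.ofReal (y ^ 2) / ENNReal.ofReal (tf - p)

lemma crossingCost_eq_ofReal {tf p : ℝ} (x y : ℝ) (hp : p ∈ Ioo 0 tf) :
    crossingCost tf x y p = ENNReal.ofReal (x ^ 2 / p + y ^ 2 / (tf - p)) := by
  have h1 := hp.1
  have h2 : 0 < tf - p := sub_pos.2 hp.2
  rw [crossingCost, ENNReal.ofReal_add (by positivity) (by positivity),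
    ENNReal.ofReal_div_of_pos h1, ENNReal.ofReal_div_of_pos h2]

/-- The convexity gap of 1/p is exactly (p - q)² / (p q (p + q)). -/
lemma inv_midpoint_add_le {p q c : ℝ} (hp : 0 < p) (hq : 0 < q) (hpc : p ≤ c) (hqc : q ≤ c) :
    2 * ((p + q) / 2)⁻¹ + (p - q) ^ 2 / (2 * c ^ 3) ≤ p⁻¹ + q⁻¹ := by
  have h : p⁻¹ + q⁻¹ - 2 * ((p + q) / 2)⁻¹ = (p - q) ^ 2 / (p * q * (p + q)) := by
    field_simp; ring
  have h2 : p * q * (p + q) ≤ 2 * c ^ 3 := by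
    have hc : 0 ≤ c := hp.le.trans hpc
    calc p * q * (p + q) ≤ c * c * (c + c) := by gcongr
      _ = 2 * c ^ 3 := by ring
  have h3 : (p - q) ^ 2 / (2 * c ^ 3) ≤ (p - q) ^ 2 / (p * q * (p + q)) := by gcongr
  linarith

/-- Strong convexity of the crossing cost in the crossing time. -/
lemma crossingCost_midpoint_add_le {tf p q : ℝ} (x y : ℝ) (hp : p ∈ Ioo 0 tf) (hq : q ∈ Ioo 0 tf) :
    2 * crossingCost tf x y ((p + q) / 2)
      + ENNReal.ofReal ((x ^ 2 + y ^ 2) * (p - q) ^ 2 / (2 * tf ^ 3))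
      ≤ crossingCost tf x y p + crossingCost tf x y q := by
  obtain ⟨hp0, hp1⟩ := hp
  obtain ⟨hq0, hq1⟩ := hq
  have htf : 0 < tf := hp0.trans hp1
  have hp2 : 0 < tf - p := sub_pos.2 hp1
  have hq2 : 0 < tf - q := sub_pos.2 hq1
  have hm : (p + q) / 2 ∈ Ioo 0 tf := ⟨by linarith, by linarith⟩
  have hm2 : 0 < tf - (p + q) / 2 := sub_pos.2 hm.2
  have hm1 := hm.1
  rw [crossingCost_eq_ofReal x y ⟨hp0, hp1⟩, crossingCost_eq_ofReal x y ⟨hq0, hq1⟩,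
    crossingCost_eq_ofReal x y hm, ← ENNReal.ofReal_ofNat 2, ← ENNReal.ofReal_mul (by norm_num),
    ← ENNReal.ofReal_add (by positivity) (by positivity),
    ← ENNReal.ofReal_add (by positivity) (by positivity)]
  apply ENNReal.ofReal_le_ofReal
  have h1 := mul_le_mul_of_nonneg_left (inv_midpoint_add_le hp0 hq0 hp1.le hq1.le) (sq_nonneg x)
  have h2 := mul_le_mul_of_nonneg_left (inv_midpoint_add_le (c := tf) hp2 hq2 (by linarith)
    (by linarith)) (sq_nonneg y)
  rw [show (tf - p + (tf - q)) / 2 = tf - (p + q) / 2 by ring,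
    show (tf - p - (tf - q)) ^ 2 = (p - q) ^ 2 by ring] at h2
  simp only [div_eq_mul_inv] at *
  linarith

/-- A schedule assigns a crossing time in `[0, tf]` to each rank `u ∈ (0, 1)`, at rate at most `r`. -/
structure IsSchedule (r tf : ℝ) (t : ℝ → ℝ) : Prop where
  mem_Icc : ∀ u ∈ Ioo (0 : ℝ) 1, t u ∈ Icc 0 tf
  le_sub : ∀ u ∈ Ioo (0 : ℝ) 1, ∀ v ∈ Ioo (0 : ℝ) 1, u ≤ v → (v - u) / r ≤ t v - t u

variable {r tf : ℝ} {t t' : ℝ → ℝ}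

/-- The positive slope leaves room on either side of an interior rank, so no denominator of the cost
vanishes. -/
lemma IsSchedule.mem_Ioo (ht : IsSchedule r tf t) (hr : 0 < r) {u : ℝ} (hu : u ∈ Ioo (0 : ℝ) 1) :
    t u ∈ Ioo 0 tf := by
  obtain ⟨h0, h1⟩ := hu
  have ha : u / 2 ∈ Ioo (0 : ℝ) 1 := ⟨by linarith, by linarith⟩
  have hb : (u + 1) / 2 ∈ Ioo (0 : ℝ) 1 := ⟨by linarith, by linarith⟩
  have h2 := ht.le_sub _ ha u ⟨h0, h1⟩ (by linarith)
  have h3 := ht.le_sub u ⟨h0, h1⟩ _ hb (by linarith)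
  have h4 : 0 < (u - u / 2) / r := div_pos (by linarith) hr
  have h5 : 0 < ((u + 1) / 2 - u) / r := div_pos (by linarith) hr
  exact ⟨by linarith [(ht.mem_Icc _ ha).1], by linarith [(ht.mem_Icc _ hb).2]⟩

lemma IsSchedule.monotoneOn (ht : IsSchedule r tf t) (hr : 0 < r) : MonotoneOn t (Ioo 0 1) :=
  fun u hu v hv huv => by
    have := ht.le_sub u hu v hv huv
    have : 0 ≤ (v - u) / r := div_nonneg (sub_nonneg.2 huv) hr.le
    linarith

lemma IsSchedule.aemeasurable (ht : IsSchedule r tf t) (hr : 0 < r) : AEMeasurable t unitVolume :=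
  aemeasurable_restrict_of_monotoneOn measurableSet_Ioo (ht.monotoneOn hr)

lemma IsSchedule.midpoint (ht : IsSchedule r tf t) (ht' : IsSchedule r tf t') :
    IsSchedule r tf fun u => (t u + t' u) / 2 where
  mem_Icc u hu := by
    have h := ht.mem_Icc u hu
    have h' := ht'.mem_Icc u hu
    exact ⟨by linarith [h.1, h'.1], by linarith [h.2, h'.2]⟩
  le_sub u hu v hv huv := by
    have h := ht.le_sub u hu v hv huv
    have h' := ht'.le_sub u hu v hv huv
    linarith

/-- The total cost of a schedule, for the initial and final positions `x u` and `y u` of rank `u`. -/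
noncomputable def energy (tf : ℝ) (x y t : ℝ → ℝ) : ℝ≥0∞ :=
  ∫⁻ u, crossingCost tf (x u) (y u) (t u) ∂unitVolume

variable {x y : ℝ → ℝ}

lemma aemeasurable_crossingCost {Ω : Type*} [MeasurableSpace Ω] {m : Measure Ω} {x y t : Ω → ℝ}
    (tf : ℝ) (hx : AEMeasurable x m) (hy : AEMeasurable y m) (ht : AEMeasurable t m) :
    AEMeasurable (fun u => crossingCost tf (x u) (y u) (t u)) m := by
  unfold crossingCost; fun_prop

lemma energy_midpoint_add_le (hr : 0 < r) (hx : AEMeasurable x unitVolume)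
    (hy : AEMeasurable y unitVolume) (ht : IsSchedule r tf t) (ht' : IsSchedule r tf t') :
    2 * energy tf x y (fun u => (t u + t' u) / 2)
      + ∫⁻ u, ENNReal.ofReal ((x u ^ 2 + y u ^ 2) * (t u - t' u) ^ 2 / (2 * tf ^ 3)) ∂unitVolume
      ≤ energy tf x y t + energy tf x y t' := by
  have hm := ht.aemeasurable hr
  have hm' := ht'.aemeasurable hr
  have hc := aemeasurable_crossingCost tf hx hy ((ht.midpoint ht').aemeasurable hr)
  rw [energy, energy, energy, ← lintegral_const_mul'' _ hc, ← lintegral_add_left' (hc.const_mul _),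
    ← lintegral_add_left' (aemeasurable_crossingCost tf hx hy hm)]
  refine lintegral_mono_ae ?_
  filter_upwards [ae_unitVolume] with u hu
  exact crossingCost_midpoint_add_le _ _ (ht.mem_Ioo hr hu) (ht'.mem_Ioo hr hu)

/-- The midpoint schedule cannot beat the minimum, so the integrated convexity gap vanishes. -/
lemma ae_eq_of_energy_minimal (hr : 0 < r) (htf : 0 < tf) (hx : AEMeasurable x unitVolume)
    (hy : AEMeasurable y unitVolume) (hx0 : ∀ᵐ u ∂unitVolume, x u ≠ 0)
    (ht : IsSchedule r tf t) (ht' : IsSchedule r tf t') (hfin : energy tf x y t ≠ ∞)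
    (hmin : ∀ s, IsSchedule r tf s → energy tf x y t ≤ energy tf x y s)
    (hle : energy tf x y t' ≤ energy tf x y t) : t =ᵐ[unitVolume] t' := by
  have hm := ht.aemeasurable hr
  have hm' := ht'.aemeasurable hr
  have h1 := energy_midpoint_add_le hr hx hy ht ht'
  have h2 : 2 * energy tf x y t
      + ∫⁻ u, ENNReal.ofReal ((x u ^ 2 + y u ^ 2) * (t u - t' u) ^ 2 / (2 * tf ^ 3)) ∂unitVolume
      ≤ 2 * energy tf x y t + 0 := by
    rw [add_zero]
    calc _ ≤ _ := by gcongr; exact hmin _ (ht.midpoint ht')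
      _ ≤ _ := h1
      _ ≤ _ := by rw [two_mul]; gcongr
  have h3 := (ENNReal.add_le_add_iff_left (ENNReal.mul_ne_top (by simp) hfin)).1 h2
  have h4 := (lintegral_eq_zero_iff' (by fun_prop)).1 (le_antisymm h3 zero_le)
  filter_upwards [h4, hx0] with u hu hu0
  simp only [Pi.zero_apply, ENNReal.ofReal_eq_zero] at hu
  by_contra hne
  have h5 : 0 < x u ^ 2 := by positivity
  have h6 : 0 < (t u - t' u) ^ 2 := by
    have := sub_ne_zero.2 hne
    positivity
  have : 0 < (x u ^ 2 + y u ^ 2) * (t u - t' u) ^ 2 / (2 * tf ^ 3) := by positivity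
  linarith

/-- A minimizing sequence converges almost everywhere if it is fast. -/
lemma ae_exists_tendsto_of_energy_le (hr : 0 < r) (htf : 0 < tf) (hx : AEMeasurable x unitVolume)
    (hy : AEMeasurable y unitVolume) (hx0 : ∀ᵐ u ∂unitVolume, x u ≠ 0) {m : ℝ≥0∞} (hm : m ≠ ∞)
    (hmin : ∀ s, IsSchedule r tf s → m ≤ energy tf x y s) {t : ℕ → ℝ → ℝ}
    (ht : ∀ n, IsSchedule r tf (t n)) (hle : ∀ n, energy tf x y (t n) ≤ m + (8⁻¹) ^ n) :
    ∀ᵐ u ∂unitVolume, ∃ l, Tendsto (fun n => t n u) atTop (𝓝 l) := by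
  have hmeas := fun n => (ht n).aemeasurable hr
  set D : ℕ → ℝ → ℝ≥0∞ := fun n u =>
    ENNReal.ofReal ((x u ^ 2 + y u ^ 2) * (t n u - t (n + 1) u) ^ 2 / (2 * tf ^ 3)) with hD
  have hDm : ∀ n, AEMeasurable (D n) unitVolume := fun n => by fun_prop
  have hDi : ∀ n, ∫⁻ u, D n u ∂unitVolume ≤ 2 * (8⁻¹) ^ n := fun n => by
    have h1 := energy_midpoint_add_le hr hx hy (ht n) (ht (n + 1))
    refine (ENNReal.add_le_add_iff_left (a := 2 * m) (ENNReal.mul_ne_top (by simp) hm)).1 ?_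
    calc _ ≤ _ := by gcongr; exact hmin _ ((ht n).midpoint (ht (n + 1)))
      _ ≤ _ := h1
      _ ≤ (m + (8⁻¹) ^ n) + (m + (8⁻¹) ^ (n + 1)) := add_le_add (hle _) (hle _)
      _ ≤ (m + (8⁻¹) ^ n) + (m + (8⁻¹) ^ n) := by
        refine add_le_add le_rfl (add_le_add le_rfl ?_)
        exact pow_le_pow_right_of_le_one'
          (ENNReal.inv_le_one.2 (by norm_num : (1 : ℝ≥0∞) ≤ 8)) (Nat.le_succ n)
      _ = _ := by ring
  -- Gaps of order 8⁻ⁿ survive the weight 4ⁿ. Finiteness of the sum at `u` bounds the squared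
  -- increments by a multiple of 4⁻ⁿ, hence the increments by one of 2⁻ⁿ.
  have hsum : ∫⁻ u, ∑' n, 4 ^ n * D n u ∂unitVolume ≠ ∞ := by
    rw [lintegral_tsum fun n => (hDm n).const_mul _]
    have : ∀ n, ∫⁻ u, 4 ^ n * D n u ∂unitVolume ≤ 2 * (2⁻¹) ^ n := fun n => by
      rw [lintegral_const_mul'' _ (hDm n)]
      calc _ ≤ 4 ^ n * (2 * (8⁻¹) ^ n) := by gcongr; exact hDi n
        _ = 2 * (4 * (8 : ℝ≥0∞)⁻¹) ^ n := by rw [mul_pow]; ring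
        _ = _ := by
          congr 2
          rw [show (8 : ℝ≥0∞) = 4 * 2 by norm_num, ENNReal.mul_inv (by simp) (by simp),
            ← mul_assoc, ENNReal.mul_inv_cancel (by simp) (by simp), one_mul]
    refine ((ENNReal.tsum_le_tsum this).trans_lt ?_).ne
    rw [ENNReal.tsum_mul_left, ENNReal.tsum_geometric]
    simp [ENNReal.mul_lt_top]
  have hfin := ae_lt_top' (AEMeasurable.tsum fun n => (hDm n).const_mul _) hsum
  filter_upwards [hfin, hx0] with u hu hu0
  set C := (∑' n, 4 ^ n * D n u).toReal with hC
  have hw : 0 < (x u ^ 2 + y u ^ 2) / (2 * tf ^ 3) := by positivity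
  have hb : ∀ n, (t n u - t (n + 1) u) ^ 2
      ≤ C / ((x u ^ 2 + y u ^ 2) / (2 * tf ^ 3)) * ((2⁻¹) ^ n) ^ 2 := fun n => by
    have h1 : 4 ^ n * D n u ≤ ∑' n, 4 ^ n * D n u := ENNReal.le_tsum n
    have h2 := ENNReal.toReal_mono hu.ne h1
    rw [← hC, hD, ENNReal.toReal_mul, ENNReal.toReal_ofReal (by positivity), ENNReal.toReal_pow,
      ENNReal.toReal_ofNat] at h2
    rw [← pow_mul, mul_comm n 2, pow_mul, div_mul_eq_mul_div, le_div_iff₀ hw]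
    have h4 : ((2 : ℝ)⁻¹ ^ 2) ^ n * 4 ^ n = 1 := by
      rw [← mul_pow]; norm_num
    have h5 := mul_le_mul_of_nonneg_left h2 (by positivity : (0 : ℝ) ≤ ((2 : ℝ)⁻¹ ^ 2) ^ n)
    rw [← mul_assoc, h4] at h5
    calc _ = _ := by ring
      _ ≤ _ := h5
      _ = _ := by ring
  have hcau : CauchySeq fun n => t n u := by
    refine cauchySeq_of_le_geometric 2⁻¹
      (√(C / ((x u ^ 2 + y u ^ 2) / (2 * tf ^ 3)))) (by norm_num) fun n => ?_
    rw [Real.dist_eq]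
    calc _ ≤ √(C / ((x u ^ 2 + y u ^ 2) / (2 * tf ^ 3)) * ((2⁻¹) ^ n) ^ 2) :=
          Real.abs_le_sqrt (hb n)
      _ = _ := by rw [Real.sqrt_mul' _ (by positivity), Real.sqrt_sq (by positivity)]
  exact cauchySeq_tendsto_of_complete hcau

lemma exists_energy_minimal (hr : 0 < r) (htf : 0 < tf) (hx : AEMeasurable x unitVolume)
    (hy : AEMeasurable y unitVolume) (hx0 : ∀ᵐ u ∂unitVolume, x u ≠ 0)
    (hfin : ∃ s, IsSchedule r tf s ∧ energy tf x y s ≠ ∞) :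
    ∃ t, IsSchedule r tf t ∧ energy tf x y t ≠ ∞ ∧
      ∀ s, IsSchedule r tf s → energy tf x y t ≤ energy tf x y s := by
  obtain ⟨s₀, hs₀, hs₀f⟩ := hfin
  set m := sInf (energy tf x y '' {s | IsSchedule r tf s}) with hm_def
  have hmin : ∀ s, IsSchedule r tf s → m ≤ energy tf x y s := fun s hs =>
    sInf_le (mem_image_of_mem _ hs)
  have hm : m ≠ ∞ := ((hmin _ hs₀).trans_lt hs₀f.lt_top).ne
  have hseq : ∀ n : ℕ, ∃ s, IsSchedule r tf s ∧ energy tf x y s ≤ m + (8⁻¹) ^ n := fun n => by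
    have : m < m + (8⁻¹) ^ n := ENNReal.lt_add_right hm (by simp)
    obtain ⟨_, ⟨s, hs, rfl⟩, h⟩ := sInf_lt_iff.1 this
    exact ⟨s, hs, h.le⟩
  choose t ht hle using hseq
  have hconv := ae_exists_tendsto_of_energy_le hr htf hx hy hx0 hm hmin ht hle
  -- Schedule constraints are required at every rank, while convergence holds only a.e. An
  -- ultrafilter limit exists everywhere in (0, 1) and agrees with the limit where there is one.
  have hlim : ∀ u, ∃ l, u ∈ Ioo (0 : ℝ) 1 →
      l ∈ Icc 0 tf ∧ Tendsto (fun n => t n u) (hyperfilter ℕ) (𝓝 l) := fun u => by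
    by_cases hu : u ∈ Ioo (0 : ℝ) 1
    · obtain ⟨l, hl, hl'⟩ := (isCompact_Icc (a := (0 : ℝ)) (b := tf)).ultrafilter_le_nhds
        ((hyperfilter ℕ).map fun n => t n u)
        (tendsto_principal.2 (Eventually.of_forall fun n => (ht n).mem_Icc u hu))
      exact ⟨l, fun _ => ⟨hl, hl'⟩⟩
    · exact ⟨0, fun h => absurd h hu⟩
  choose τ hτ using hlim
  have hτs : IsSchedule r tf τ :=
    ⟨fun u hu => (hτ u hu).1, fun u hu v hv huv => ge_of_tendsto ((hτ v hv).2.sub (hτ u hu).2)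
      (Eventually.of_forall fun n => (ht n).le_sub u hu v hv huv)⟩
  have hτm : energy tf x y τ ≤ m := by
    have h1 : energy tf x y τ
        = ∫⁻ u, liminf (fun n => crossingCost tf (x u) (y u) (t n u)) atTop ∂unitVolume := by
      refine lintegral_congr_ae ?_
      filter_upwards [hconv, ae_unitVolume] with u ⟨l, hl⟩ hu
      have hl' : l = τ u := tendsto_nhds_unique
        (hl.mono_left (Nat.hyperfilter_le_atTop)) (hτ u hu).2
      rw [hl'] at hl
      have h0 := hτs.mem_Ioo hr hu
      have h0' : tf - τ u ≠ 0 := (sub_pos.2 h0.2).ne'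
      refine (Tendsto.liminf_eq ?_).symm
      rw [crossingCost_eq_ofReal _ _ h0]
      simp_rw [fun n => crossingCost_eq_ofReal (x u) (y u) ((ht n).mem_Ioo hr hu)]
      refine ENNReal.tendsto_ofReal ?_
      exact (tendsto_const_nhds.div hl h0.1.ne').add
        (tendsto_const_nhds.div (tendsto_const_nhds.sub hl) h0')
    have h2 : Tendsto (fun n => energy tf x y (t n)) atTop (𝓝 m) := by
      refine tendsto_of_tendsto_of_tendsto_of_le_of_le tendsto_const_nhds ?_
        (fun n => hmin _ (ht n)) hle
      simpa using tendsto_const_nhds.add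
        (ENNReal.tendsto_pow_atTop_nhds_zero_of_lt_one (r := 8⁻¹) (by norm_num))
    rw [h1]
    refine (lintegral_liminf_le' fun n =>
      aemeasurable_crossingCost tf hx hy ((ht n).aemeasurable hr)).trans ?_
    exact h2.liminf_eq.le
  exact ⟨τ, hτs, (hτm.trans_lt hm.lt_top).ne, fun s hs => hτm.trans (hmin s hs)⟩

end Schedule

/-! ### From schedules to admissible couplings. -/

section Plan

variable {r tf : ℝ} {t x y : ℝ → ℝ}

/-- The law of `(x, y, t)` under Lebesgue measure on `(0, 1)`. -/
noncomputable def planOf (x y t : ℝ → ℝ) : Measure (ℝ × ℝ × ℝ) :=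
  unitVolume.map fun u => (x u, y u, t u)

lemma cost_eq_lintegral_crossingCost (tf : ℝ) (π : Measure (ℝ × ℝ × ℝ)) :
    cost tf π = ∫⁻ p, crossingCost tf p.1 p.2.1 p.2.2 ∂π := rfl

lemma cost_planOf (tf : ℝ) (hx : AEMeasurable x unitVolume) (hy : AEMeasurable y unitVolume)
    (ht : AEMeasurable t unitVolume) : cost tf (planOf x y t) = energy tf x y t := by
  rw [cost_eq_lintegral_crossingCost, planOf, lintegral_map' _ (hx.prodMk (hy.prodMk ht))]
  · rfl
  · exact aemeasurable_crossingCost tf (by fun_prop) (by fun_prop) (by fun_prop)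

/-- The inverse of `t` on its image is `r`-Lipschitz, so it multiplies one-dimensional Hausdorff
measure by at most `r`. -/
lemma IsSchedule.map_le (ht : IsSchedule r tf t) (hr : 0 < r) :
    unitVolume.map t ≤ ENNReal.ofReal r • volume.restrict (Icc 0 tf) := by
  refine Measure.le_iff.2 fun B hB => ?_
  rw [Measure.map_apply_of_aemeasurable (ht.aemeasurable hr) hB, unitVolume,
    Measure.restrict_apply' measurableSet_Ioo, Measure.smul_apply, smul_eq_mul,
    Measure.restrict_apply hB]
  set S := t ⁻¹' B ∩ Ioo 0 1
  have hslope : ∀ u ∈ Ioo (0 : ℝ) 1, ∀ v ∈ Ioo (0 : ℝ) 1, |u - v| ≤ r * |t u - t v| := by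
    have key : ∀ u ∈ Ioo (0 : ℝ) 1, ∀ v ∈ Ioo (0 : ℝ) 1, u ≤ v → |u - v| ≤ r * |t u - t v| :=
      fun u hu v hv huv => by
        have h := ht.le_sub u hu v hv huv
        rw [div_le_iff₀ hr] at h
        rw [abs_sub_comm, abs_of_nonneg (sub_nonneg.2 huv), abs_sub_comm]
        calc _ ≤ _ := h
          _ = r * (t v - t u) := mul_comm _ _
          _ ≤ _ := by gcongr; exact le_abs_self _
    intro u hu v hv
    rcases le_total u v with h | h
    · exact key u hu v hv h
    · rw [abs_sub_comm, abs_sub_comm (t u)]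
      exact key v hv u hu h
  have hinj : InjOn t (Ioo 0 1) := fun u hu v hv huv => by
    have := hslope u hu v hv
    rw [huv, sub_self, abs_zero, mul_zero] at this
    exact sub_eq_zero.1 (abs_nonpos_iff.1 this)
  have hinv : LeftInvOn (Function.invFunOn t (Ioo 0 1)) t (Ioo 0 1) := hinj.leftInvOn_invFunOn
  have hS : Function.invFunOn t (Ioo 0 1) '' (t '' S) = S :=
    (hinv.mono inter_subset_right).image_image
  have hlip : LipschitzOnWith r.toNNReal (Function.invFunOn t (Ioo 0 1)) (t '' S) := by
    refine LipschitzOnWith.of_dist_le_mul ?_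
    rintro _ ⟨u, hu, rfl⟩ _ ⟨v, hv, rfl⟩
    rw [hinv hu.2, hinv hv.2, Real.dist_eq, Real.dist_eq, Real.coe_toNNReal _ hr.le]
    exact hslope u hu.2 v hv.2
  have h := hlip.hausdorffMeasure_image_le zero_le_one
  rw [hS, hausdorffMeasure_real, ENNReal.rpow_one] at h
  refine h.trans ?_
  change ENNReal.ofReal r * _ ≤ _
  gcongr
  rintro _ ⟨u, hu, rfl⟩
  exact ⟨hu.1, ht.mem_Icc u hu.2⟩

lemma isAdmissible_planOf (hr : 0 < r) (hx : AEMeasurable x unitVolume)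
    (hy : AEMeasurable y unitVolume) (ht : IsSchedule r tf t) :
    IsAdmissible (unitVolume.map x) (unitVolume.map y) r tf (planOf x y t) := by
  have hp : AEMeasurable (fun u => (x u, y u, t u)) unitVolume :=
    hx.prodMk (hy.prodMk (ht.aemeasurable hr))
  refine ⟨Measure.isProbabilityMeasure_map hp, ?_, ?_, ?_⟩
  · exact AEMeasurable.map_map_of_aemeasurable (by fun_prop) hp
  · exact AEMeasurable.map_map_of_aemeasurable (by fun_prop) hp
  · rw [planOf, AEMeasurable.map_map_of_aemeasurable (by fun_prop) hp]
    exact ht.map_le hr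

end Plan

/-! ### Positions as nonincreasing functions of time. -/

section Position

/-- The position function of time: at time `s`, the mass `1 - cdf ρ s` is still to cross. -/
noncomputable def position (a b : ℝ) (m ρ : Measure ℝ) (s : ℝ) : ℝ := quantile a b m (1 - cdf ρ s)

variable {a b : ℝ} {m ρ : Measure ℝ} [IsProbabilityMeasure m]

lemma antitone_position (hm : m (Icc a b)ᶜ = 0) : Antitone (position a b m ρ) := fun s s' h =>
  quantile_monotoneOn hm (by simpa using cdf_nonneg ρ s') (by simpa using cdf_nonneg ρ s)
    (sub_le_sub_left (monotone_cdf ρ h) 1)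

lemma measurable_position (hm : m (Icc a b)ᶜ = 0) : Measurable (position a b m ρ) :=
  (antitone_position hm).measurable

end Position

/-! ### From time marginals back to schedules and densities. -/

section TimeMarginal

variable {r tf : ℝ} {ρ : Measure ℝ}

lemma compl_Icc_eq_zero_of_le (hρ : ρ ≤ ENNReal.ofReal r • volume.restrict (Icc 0 tf)) :
    ρ (Icc 0 tf)ᶜ = 0 := by
  refine le_antisymm ((hρ _).trans ?_) zero_le
  simp

lemma measure_singleton_eq_zero_of_le
    (hρ : ρ ≤ ENNReal.ofReal r • volume.restrict (Icc 0 tf)) (s : ℝ) : ρ {s} = 0 := by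
  refine le_antisymm ((hρ _).trans ?_) zero_le
  simp

lemma ae_mem_Ioo_of_le (hρ : ρ ≤ ENNReal.ofReal r • volume.restrict (Icc 0 tf)) :
    ∀ᵐ s ∂ρ, s ∈ Ioo 0 tf := by
  have h1 : ∀ᵐ s ∂ρ, s ∈ Icc 0 tf := compl_Icc_eq_zero_of_le hρ
  have h2 : ∀ s, ∀ᵐ s' ∂ρ, s' ≠ s := fun s =>
    measure_eq_zero_iff_ae_notMem.1 (measure_singleton_eq_zero_of_le hρ s)
  filter_upwards [h1, h2 0, h2 tf] with s hs h0 h1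
  exact ⟨lt_of_le_of_ne hs.1 h0.symm, lt_of_le_of_ne hs.2 h1⟩

variable [IsProbabilityMeasure ρ]

lemma cdf_sub_le (hr : 0 < r) (hρ : ρ ≤ ENNReal.ofReal r • volume.restrict (Icc 0 tf)) {a b : ℝ}
    (hab : a ≤ b) : cdf ρ b - cdf ρ a ≤ r * (b - a) := by
  have h1 : ρ (Ioc a b) = ENNReal.ofReal (cdf ρ b - cdf ρ a) := by
    conv_lhs => rw [← measure_cdf ρ]
    exact (cdf ρ).measure_Ioc a b
  have h2 : ρ (Ioc a b) ≤ ENNReal.ofReal (r * (b - a)) := by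
    refine (hρ _).trans ?_
    rw [Measure.smul_apply, smul_eq_mul, ENNReal.ofReal_mul hr.le, ← Real.volume_Ioc]
    gcongr
    exact Measure.restrict_le_self
  rw [h1] at h2
  exact (ENNReal.ofReal_le_ofReal_iff (mul_nonneg hr.le (sub_nonneg.2 hab))).1 h2

lemma continuous_cdf_of_le (hr : 0 < r)
    (hρ : ρ ≤ ENNReal.ofReal r • volume.restrict (Icc 0 tf)) : Continuous (cdf ρ) := by
  refine (LipschitzWith.of_le_add_mul r.toNNReal fun a b => ?_).continuous
  rw [Real.coe_toNNReal _ hr.le, Real.dist_eq]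
  rcases le_total a b with h | h
  · have := monotone_cdf ρ h
    have : 0 ≤ r * |a - b| := by positivity
    linarith
  · have := cdf_sub_le hr hρ h
    rw [abs_of_nonneg (sub_nonneg.2 h)]
    linarith

/-- Converse of `IsSchedule.map_le`: the cdf is `r`-Lipschitz and inverts the quantile, whose slope
is therefore at least 1/r. -/
lemma isSchedule_quantile (hr : 0 < r)
    (hρ : ρ ≤ ENNReal.ofReal r • volume.restrict (Icc 0 tf)) :
    IsSchedule r tf (quantile 0 tf ρ) := by
  have hm := compl_Icc_eq_zero_of_le hρ
  have hc := continuous_cdf_of_le hr hρ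
  refine ⟨fun u hu => quantile_mem_Icc hm hu.2.le, fun u hu v hv huv => ?_⟩
  have h := cdf_sub_le hr hρ (quantile_monotoneOn hm hu.2.le hv.2.le huv)
  rw [cdf_quantile hm hc hu.1 hu.2.le, cdf_quantile hm hc hv.1 hv.2.le] at h
  rw [div_le_iff₀ hr]
  linarith

lemma exists_density_of_le (hr : 0 < r)
    (hρ : ρ ≤ ENNReal.ofReal r • volume.restrict (Icc 0 tf)) :
    ∃ σ : ℝ → ℝ, Measurable σ ∧ (∀ s, 0 ≤ σ s ∧ σ s ≤ r) ∧
      ρ = (volume.restrict (Icc 0 tf)).withDensity fun s => ENNReal.ofReal (σ s) := by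
  set vol := (volume : Measure ℝ).restrict (Icc 0 tf)
  have hac : ρ ≪ vol := (Measure.absolutelyContinuous_of_le hρ).trans
    (Measure.AbsolutelyContinuous.rfl.smul_left _)
  have hle : ρ.rnDeriv vol ≤ᵐ[vol] fun _ => ENNReal.ofReal r := by
    refine ae_le_of_forall_setLIntegral_le_of_sigmaFinite (Measure.measurable_rnDeriv _ _)
      fun s hs _ => ?_
    rw [Measure.setLIntegral_rnDeriv hac, setLIntegral_const]
    exact hρ s
  -- Truncation makes the bound by `r` hold everywhere instead of a.e.
  refine ⟨fun s => min r (ρ.rnDeriv vol s).toReal, by fun_prop,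
    fun s => ⟨le_min hr.le ENNReal.toReal_nonneg, min_le_left _ _⟩, ?_⟩
  conv_lhs => rw [← Measure.withDensity_rnDeriv_eq ρ vol hac]
  refine withDensity_congr_ae ?_
  filter_upwards [hle] with s hs
  have hfin : ρ.rnDeriv vol s ≠ ∞ := (hs.trans_lt ENNReal.ofReal_lt_top).ne
  rw [min_eq_right (ENNReal.toReal_le_of_le_ofReal hr.le hs), ENNReal.ofReal_toReal hfin]

variable {a b : ℝ} {m : Measure ℝ}

lemma position_quantile (hr : 0 < r)
    (hρ : ρ ≤ ENNReal.ofReal r • volume.restrict (Icc 0 tf)) {u : ℝ} (hu : u ∈ Ioo (0 : ℝ) 1) :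
    position a b m ρ (quantile 0 tf ρ u) = quantile a b m (1 - u) := by
  rw [position, cdf_quantile (compl_Icc_eq_zero_of_le hρ) (continuous_cdf_of_le hr hρ) hu.1 hu.2.le]

variable [IsProbabilityMeasure m]

lemma map_position (hr : 0 < r) (hρ : ρ ≤ ENNReal.ofReal r • volume.restrict (Icc 0 tf))
    (hm : m (Icc a b)ᶜ = 0) : ρ.map (position a b m ρ) = m := by
  have h0 := compl_Icc_eq_zero_of_le hρ
  conv_lhs => enter [2]; rw [← map_quantile h0]
  rw [AEMeasurable.map_map_of_aemeasurable (measurable_position hm).aemeasurable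
    (aemeasurable_quantile h0)]
  conv_rhs => rw [← map_quantile_one_sub hm]
  refine Measure.map_congr ?_
  filter_upwards [ae_unitVolume] with u hu
  exact position_quantile hr hρ hu

end TimeMarginal

/-! ### The antitone coupling with a given time marginal. -/

section Coupling

variable {μ ν : Measure ℝ} {M r tf : ℝ} {π : Measure (ℝ × ℝ × ℝ)}

/-- The time marginal of a coupling. -/
noncomputable def timeMarginal (π : Measure (ℝ × ℝ × ℝ)) : Measure ℝ := π.map fun p => p.2.2

lemma cost_eq_add (tf : ℝ) (π : Measure (ℝ × ℝ × ℝ)) :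
    cost tf π = ∫⁻ p, ENNReal.ofReal ((-p.1) ^ 2) / ENNReal.ofReal p.2.2 ∂π
        + ∫⁻ p, ENNReal.ofReal (p.2.1 ^ 2) / ENNReal.ofReal (tf - p.2.2) ∂π := by
  rw [← lintegral_add_left (by fun_prop)]
  simp only [neg_sq]
  rfl

lemma IsAdmissible.isProbabilityMeasure_timeMarginal (hπ : IsAdmissible μ ν r tf π) :
    IsProbabilityMeasure (timeMarginal π) := by
  have := hπ.isProbabilityMeasure
  exact Measure.isProbabilityMeasure_map (by fun_prop)

variable [IsProbabilityMeasure μ] [IsProbabilityMeasure ν]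

/-- Writes the cost of the antitone coupling over `π` itself, so that both couplings become
variables on one probability space and the rearrangement inequality applies. The sign makes the
first variable nonnegative. -/
lemma IsAdmissible.energy_eq (hπ : IsAdmissible μ ν r tf π) (hμ : μ (Icc (-M) 0)ᶜ = 0)
    (hν : ν (Icc 0 M)ᶜ = 0) (hr : 0 < r) :
    energy tf (fun u => quantile (-M) 0 μ (1 - u)) (fun u => quantile 0 M ν (1 - u))
      (quantile 0 tf (timeMarginal π))
      = ∫⁻ p, ENNReal.ofReal ((-position (-M) 0 μ (timeMarginal π) p.2.2) ^ 2)
            / ENNReal.ofReal p.2.2 ∂π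
        + ∫⁻ p, ENNReal.ofReal (position 0 M ν (timeMarginal π) p.2.2 ^ 2)
            / ENNReal.ofReal (tf - p.2.2) ∂π := by
  have := hπ.isProbabilityMeasure_timeMarginal
  have hρ : timeMarginal π ≤ _ := hπ.map_t_le
  have hX : Measurable (position (-M) 0 μ (timeMarginal π)) := measurable_position hμ
  have hY : Measurable (position 0 M ν (timeMarginal π)) := measurable_position hν
  have h0 := compl_Icc_eq_zero_of_le hρ
  rw [← lintegral_add_left (by fun_prop)]
  simp only [neg_sq]
  have h1 : ∫⁻ s, crossingCost tf (position (-M) 0 μ (timeMarginal π) s)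
      (position 0 M ν (timeMarginal π) s) s ∂(timeMarginal π) = ∫⁻ p, crossingCost tf
        (position (-M) 0 μ (timeMarginal π) p.2.2) (position 0 M ν (timeMarginal π) p.2.2) p.2.2 ∂π := by
    conv_lhs => enter [1]; rw [timeMarginal]
    refine lintegral_map' (aemeasurable_crossingCost tf ?_ ?_ ?_) ?_ <;> fun_prop
  refine Eq.trans ?_ h1
  conv_rhs => enter [1]; rw [← map_quantile h0]
  rw [lintegral_map' (aemeasurable_crossingCost tf (by fun_prop) (by fun_prop) (by fun_prop))
    (aemeasurable_quantile h0)]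
  refine lintegral_congr_ae ?_
  filter_upwards [ae_unitVolume] with u hu
  rw [position_quantile hr hρ hu, position_quantile hr hρ hu]

end Coupling

/-! ### Reduction of the problem to schedules. -/

section Optimality

variable {μ ν : Measure ℝ} {M r tf : ℝ} {π : Measure (ℝ × ℝ × ℝ)}

lemma IsAdmissible.ae_time_mem_Ioo (hπ : IsAdmissible μ ν r tf π) :
    ∀ᵐ p ∂π, p.2.2 ∈ Ioo 0 tf :=
  ae_of_ae_map (by fun_prop) (ae_mem_Ioo_of_le hπ.map_t_le)

lemma IsAdmissible.measure_time_eq (hπ : IsAdmissible μ ν r tf π) (s : ℝ) :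
    π {p | p.2.2 = s} = 0 := by
  have := measure_singleton_eq_zero_of_le hπ.map_t_le s
  rwa [Measure.map_apply (by fun_prop) (measurableSet_singleton s)] at this

lemma IsAdmissible.ae_nonneg_neg_x (hπ : IsAdmissible μ ν r tf π) (hμ : μ (Icc (-M) 0)ᶜ = 0) :
    ∀ᵐ p ∂π, 0 ≤ -p.1 := by
  have h : ∀ᵐ s ∂(π.map fun p => p.1), s ∈ Icc (-M) 0 := by rw [hπ.map_x]; exact hμ
  filter_upwards [ae_of_ae_map (by fun_prop) h] with p hp
  linarith [hp.2]

lemma IsAdmissible.ae_nonneg_y (hπ : IsAdmissible μ ν r tf π) (hν : ν (Icc 0 M)ᶜ = 0) :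
    ∀ᵐ p ∂π, 0 ≤ p.2.1 := by
  have h : ∀ᵐ s ∂(π.map fun p => p.2.1), s ∈ Icc 0 M := by rw [hπ.map_y]; exact hν
  filter_upwards [ae_of_ae_map (by fun_prop) h] with p hp
  exact hp.1

lemma IsAdmissible.map_neg_x [IsProbabilityMeasure μ] (hπ : IsAdmissible μ ν r tf π) (hμ : μ (Icc (-M) 0)ᶜ = 0)
    (hr : 0 < r) :
    π.map (fun p => -p.1) = π.map fun p => -position (-M) 0 μ (timeMarginal π) p.2.2 := by
  have := hπ.isProbabilityMeasure_timeMarginal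
  have hX : Measurable (position (-M) 0 μ (timeMarginal π)) := measurable_position hμ
  have h1 : π.map (fun p => -p.1) = (π.map fun p => p.1).map Neg.neg :=
    (Measure.map_map (by fun_prop) (by fun_prop)).symm
  have h2 : π.map (fun p => -position (-M) 0 μ (timeMarginal π) p.2.2)
      = ((timeMarginal π).map (position (-M) 0 μ (timeMarginal π))).map Neg.neg := by
    conv_rhs => enter [2, 2]; rw [timeMarginal]
    rw [Measure.map_map hX (by fun_prop), Measure.map_map (by fun_prop) (by fun_prop)]
    rfl
  rw [h1, h2, map_position (ρ := timeMarginal π) hr hπ.map_t_le hμ, hπ.map_x]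

lemma IsAdmissible.map_y_eq [IsProbabilityMeasure ν] (hπ : IsAdmissible μ ν r tf π) (hν : ν (Icc 0 M)ᶜ = 0)
    (hr : 0 < r) :
    π.map (fun p => p.2.1) = π.map fun p => position 0 M ν (timeMarginal π) p.2.2 := by
  have := hπ.isProbabilityMeasure_timeMarginal
  have hY : Measurable (position 0 M ν (timeMarginal π)) := measurable_position hν
  have h2 : π.map (fun p => position 0 M ν (timeMarginal π) p.2.2)
      = (timeMarginal π).map (position 0 M ν (timeMarginal π)) := by
    conv_rhs => enter [2]; rw [timeMarginal]
    rw [Measure.map_map hY (by fun_prop)]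
    rfl
  rw [h2, map_position (ρ := timeMarginal π) hr hπ.map_t_le hν, hπ.map_y]

variable [IsProbabilityMeasure μ] [IsProbabilityMeasure ν]

/-- Every coupling costs at least as much as the antitone one with the same time marginal. -/
lemma IsAdmissible.energy_le_cost (hπ : IsAdmissible μ ν r tf π) (hμ : μ (Icc (-M) 0)ᶜ = 0)
    (hν : ν (Icc 0 M)ᶜ = 0) (hr : 0 < r) :
    energy tf (fun u => quantile (-M) 0 μ (1 - u)) (fun u => quantile 0 M ν (1 - u))
      (quantile 0 tf (timeMarginal π)) ≤ cost tf π := by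
  have := hπ.isProbabilityMeasure
  have := hπ.isProbabilityMeasure_timeMarginal
  have hX : Measurable (position (-M) 0 μ (timeMarginal π)) := measurable_position hμ
  have hY : Measurable (position 0 M ν (timeMarginal π)) := measurable_position hν
  have hT := hπ.ae_time_mem_Ioo
  rw [hπ.energy_eq hμ hν hr, cost_eq_add]
  gcongr ?_ + ?_
  · exact lintegral_sq_div_le (by fun_prop) (by fun_prop) (by fun_prop) (hπ.map_neg_x hμ hr)
      (fun p q h => neg_le_neg (antitone_position hμ h)) (hπ.ae_nonneg_neg_x hμ) hT
  -- For y the relevant time is the remaining one, `tf - t`, in which the position is nondecreasing.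
  · refine lintegral_sq_div_le (c := tf) (by fun_prop) (by fun_prop) (by fun_prop)
      (hπ.map_y_eq hν hr) (fun p q h => antitone_position hν (by linarith)) (hπ.ae_nonneg_y hν) ?_
    filter_upwards [hT] with p hp
    exact ⟨by linarith [hp.2], by linarith [hp.1]⟩

/-- Equality in `IsAdmissible.energy_le_cost` forces the coupling to be carried by a graph. -/
lemma IsAdmissible.eq_map_timeMarginal (hπ : IsAdmissible μ ν r tf π)
    (hμ : μ (Icc (-M) 0)ᶜ = 0) (hν : ν (Icc 0 M)ᶜ = 0) (hr : 0 < r)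
    (hfin : energy tf (fun u => quantile (-M) 0 μ (1 - u)) (fun u => quantile 0 M ν (1 - u))
      (quantile 0 tf (timeMarginal π)) ≠ ∞)
    (hle : cost tf π ≤ energy tf (fun u => quantile (-M) 0 μ (1 - u))
      (fun u => quantile 0 M ν (1 - u)) (quantile 0 tf (timeMarginal π))) :
    π = (timeMarginal π).map fun s =>
      (position (-M) 0 μ (timeMarginal π) s, position 0 M ν (timeMarginal π) s, s) := by
  have := hπ.isProbabilityMeasure
  have := hπ.isProbabilityMeasure_timeMarginal
  have hX : Measurable (position (-M) 0 μ (timeMarginal π)) := measurable_position hμ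
  have hY : Measurable (position 0 M ν (timeMarginal π)) := measurable_position hν
  have hT := hπ.ae_time_mem_Ioo
  have hT' : ∀ᵐ p ∂π, tf - p.2.2 ∈ Ioo 0 tf := by
    filter_upwards [hT] with p hp
    exact ⟨by linarith [hp.2], by linarith [hp.1]⟩
  have hatom : ∀ s, π {p | tf - p.2.2 = s} = 0 := fun s => by
    refine measure_mono_null (fun p (hp : tf - p.2.2 = s) => ?_) (hπ.measure_time_eq (tf - s))
    change p.2.2 = tf - s
    linarith
  have hmx : ∀ p q : ℝ × ℝ × ℝ, p.2.2 ≤ q.2.2 → -position (-M) 0 μ (timeMarginal π) p.2.2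
      ≤ -position (-M) 0 μ (timeMarginal π) q.2.2 :=
    fun p q h => neg_le_neg (antitone_position hμ h)
  have hmy : ∀ p q : ℝ × ℝ × ℝ, tf - p.2.2 ≤ tf - q.2.2 →
      position 0 M ν (timeMarginal π) p.2.2 ≤ position 0 M ν (timeMarginal π) q.2.2 :=
    fun p q h => antitone_position hν (by linarith)
  have h1 := lintegral_sq_div_le (by fun_prop) (by fun_prop) (by fun_prop) (hπ.map_neg_x hμ hr)
      hmx (hπ.ae_nonneg_neg_x hμ) hT
  have h2 := lintegral_sq_div_le (by fun_prop) (by fun_prop) (by fun_prop) (hπ.map_y_eq hν hr)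
      hmy (hπ.ae_nonneg_y hν) hT'
  rw [hπ.energy_eq hμ hν hr] at hfin hle
  rw [cost_eq_add] at hle
  obtain ⟨hf1, hf2⟩ := ENNReal.add_ne_top.1 hfin
  -- Both halves are bounded below separately and are finite, so equality of the sums forces
  -- equality of each.
  have hxle := (ENNReal.add_le_add_iff_right hf2).1 ((add_le_add le_rfl h2).trans hle)
  have hyle := (ENNReal.add_le_add_iff_left hf1).1 ((add_le_add h1 le_rfl).trans hle)
  have hx := ae_eq_of_lintegral_sq_div_le (by fun_prop) (by fun_prop) (by fun_prop)
    (hπ.map_neg_x hμ hr) hmx (hπ.ae_nonneg_neg_x hμ) hT hπ.measure_time_eq hf1 hxle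
  have hy := ae_eq_of_lintegral_sq_div_le (by fun_prop) (by fun_prop) (by fun_prop)
    (hπ.map_y_eq hν hr) hmy (hπ.ae_nonneg_y hν) hT' hatom hf2 hyle
  conv_rhs => enter [2]; rw [timeMarginal]
  rw [Measure.map_map (by fun_prop) (by fun_prop)]
  conv_lhs => rw [← Measure.map_id (μ := π)]
  refine Measure.map_congr ?_
  filter_upwards [hx, hy] with p hpx hpy
  exact Prod.ext (neg_injective hpx) (Prod.ext hpy rfl)

lemma map_timeMarginal_eq_planOf (hπ : IsAdmissible μ ν r tf π) (hμ : μ (Icc (-M) 0)ᶜ = 0)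
    (hν : ν (Icc 0 M)ᶜ = 0) (hr : 0 < r) :
    ((timeMarginal π).map fun s =>
      (position (-M) 0 μ (timeMarginal π) s, position 0 M ν (timeMarginal π) s, s))
      = planOf (fun u => quantile (-M) 0 μ (1 - u)) (fun u => quantile 0 M ν (1 - u))
        (quantile 0 tf (timeMarginal π)) := by
  have := hπ.isProbabilityMeasure_timeMarginal
  have hρ : timeMarginal π ≤ _ := hπ.map_t_le
  have hX : Measurable (position (-M) 0 μ (timeMarginal π)) := measurable_position hμ
  have hY : Measurable (position 0 M ν (timeMarginal π)) := measurable_position hν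
  have h0 := compl_Icc_eq_zero_of_le hρ
  conv_lhs => enter [2]; rw [← map_quantile h0]
  rw [AEMeasurable.map_map_of_aemeasurable (by fun_prop) (aemeasurable_quantile h0)]
  refine Measure.map_congr ?_
  filter_upwards [ae_unitVolume] with u hu
  simp only [Function.comp_apply, position_quantile hr hρ hu]

lemma exists_isSchedule_energy_ne_top (hμ : μ (Icc (-M) 0)ᶜ = 0) (hν : ν (Icc 0 M)ᶜ = 0)
    (hr : 0 < r) (hrtf : 1 < r * tf) :
    ∃ s, IsSchedule r tf s ∧ energy tf (fun u => quantile (-M) 0 μ (1 - u))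
      (fun u => quantile 0 M ν (1 - u)) s ≠ ∞ := by
  have hlt : 1 / r < tf := by rwa [div_lt_iff₀ hr, mul_comm]
  -- Half the slack: crossing at full rate from time `δ` on stays `δ` away from both 0 and `tf`,
  -- which bounds the cost.
  set δ := (tf - 1 / r) / 2 with hδ
  have hδ0 : 0 < δ := by linarith
  have hb : ∀ u ∈ Ioo (0 : ℝ) 1, 0 ≤ u / r ∧ u / r ≤ 1 / r := fun u hu =>
    ⟨div_nonneg hu.1.le hr.le, by gcongr; exact hu.2.le⟩
  refine ⟨fun u => δ + u / r, ⟨fun u hu => ?_, fun u _ v _ _ => ?_⟩, ?_⟩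
  · have := hb u hu
    exact ⟨by linarith, by linarith⟩
  · rw [sub_div]; linarith
  · have hle : energy tf (fun u => quantile (-M) 0 μ (1 - u))
        (fun u => quantile 0 M ν (1 - u)) (fun u => δ + u / r)
        ≤ ∫⁻ _, ENNReal.ofReal (M ^ 2) / ENNReal.ofReal δ
          + ENNReal.ofReal (M ^ 2) / ENNReal.ofReal δ ∂unitVolume := by
      refine lintegral_mono_ae ?_
      filter_upwards [ae_unitVolume] with u hu
      have h1 := hb u hu
      have hx := quantile_mem_Icc hμ (u := 1 - u) (by linarith [hu.1])
      have hy := quantile_mem_Icc hν (u := 1 - u) (by linarith [hu.1])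
      have hx2 : quantile (-M) 0 μ (1 - u) ^ 2 ≤ M ^ 2 := by nlinarith [hx.1, hx.2]
      have hy2 : quantile 0 M ν (1 - u) ^ 2 ≤ M ^ 2 := by nlinarith [hy.1, hy.2]
      unfold crossingCost
      gcongr <;> linarith
    refine (hle.trans_lt ?_).ne
    rw [lintegral_const, measure_univ, mul_one]
    have : ENNReal.ofReal (M ^ 2) / ENNReal.ofReal δ < ∞ :=
      ENNReal.div_lt_top ENNReal.ofReal_ne_top (by simpa using hδ0)
    exact ENNReal.add_lt_top.2 ⟨this, this⟩

/-- There is a unique optimal coupling, and it is the antitone coupling of its time marginal. -/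
lemma existsUnique_isMinimizer_and_eq_map (hμ : μ (Icc (-M) 0)ᶜ = 0) (hμ0 : μ {0} = 0)
    (hν : ν (Icc 0 M)ᶜ = 0) (hr : 0 < r) (htf : 0 < tf) (hrtf : 1 < r * tf) :
    (∃! π, IsMinimizer μ ν r tf π) ∧ ∀ π, IsMinimizer μ ν r tf π →
      π = (timeMarginal π).map fun s =>
        (position (-M) 0 μ (timeMarginal π) s, position 0 M ν (timeMarginal π) s, s) := by
  set x : ℝ → ℝ := fun u => quantile (-M) 0 μ (1 - u) with hx_def
  set y : ℝ → ℝ := fun u => quantile 0 M ν (1 - u) with hy_def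
  have hx : AEMeasurable x unitVolume := aemeasurable_quantile_one_sub hμ
  have hy : AEMeasurable y unitVolume := aemeasurable_quantile_one_sub hν
  have hx0 : ∀ᵐ u ∂unitVolume, x u ≠ 0 := by
    refine ae_of_ae_map (p := fun z => z ≠ 0) hx ?_
    rw [map_quantile_one_sub hμ]
    exact measure_eq_zero_iff_ae_notMem.1 hμ0
  obtain ⟨t, ht, hfin, hmin⟩ := exists_energy_minimal hr htf hx hy hx0
    (exists_isSchedule_energy_ne_top hμ hν hr hrtf)
  have hcost : cost tf (planOf x y t) = energy tf x y t := cost_planOf tf hx hy (ht.aemeasurable hr)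
  have hadm : IsAdmissible μ ν r tf (planOf x y t) := by
    have := isAdmissible_planOf hr hx hy ht
    rwa [map_quantile_one_sub hμ, map_quantile_one_sub hν] at this
  have hsched : ∀ π, IsAdmissible μ ν r tf π → IsSchedule r tf (quantile 0 tf (timeMarginal π)) :=
    fun π hπ => by
      have := hπ.isProbabilityMeasure_timeMarginal
      exact isSchedule_quantile hr hπ.map_t_le
  have hgraph : ∀ π, IsMinimizer μ ν r tf π →
      π = (timeMarginal π).map (fun s =>
        (position (-M) 0 μ (timeMarginal π) s, position 0 M ν (timeMarginal π) s, s))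
      ∧ t =ᵐ[unitVolume] quantile 0 tf (timeMarginal π) := fun π hπ => by
    -- `h1`, `h3` and `h2` close a cycle through the cost of `π`, the minimal energy and the energy
    -- of the schedule of `π`, so all three are equal.
    have h1 : cost tf π ≤ energy tf x y t := (hπ.2 _ hadm).trans hcost.le
    have h2 := hπ.1.energy_le_cost hμ hν hr
    have h3 := hmin _ (hsched π hπ.1)
    exact ⟨hπ.1.eq_map_timeMarginal hμ hν hr ((h2.trans h1).trans_lt hfin.lt_top).ne (h1.trans h3),
      ae_eq_of_energy_minimal hr htf hx hy hx0 ht (hsched π hπ.1) hfin hmin (h2.trans h1)⟩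
  refine ⟨⟨planOf x y t, ⟨hadm, fun π hπ => ?_⟩, fun π hπ => ?_⟩, fun π hπ => (hgraph π hπ).1⟩
  · rw [hcost]
    exact (hmin _ (hsched π hπ)).trans (hπ.energy_le_cost hμ hν hr)
  · obtain ⟨h1, h2⟩ := hgraph π hπ
    rw [h1, map_timeMarginal_eq_planOf hπ.1 hμ hν hr]
    refine Measure.map_congr ?_
    filter_upwards [h2] with u hu
    rw [hu]

end Optimality

end TollTransport

/-! ### The main theorem. -/

theorem proposition2 (μ ν : Measure ℝ) [IsProbabilityMeasure μ] [IsProbabilityMeasure ν]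
    (M r tf : ℝ) (hμ : μ (Ioo (-M) 0)ᶜ = 0) (hν : ν (Ioo 0 M)ᶜ = 0)
    (hr : 0 < r) (htf : 0 < tf) (hrtf : 1 < r * tf) :
    (∃! π : Measure (ℝ × ℝ × ℝ), TollTransport.IsMinimizer μ ν r tf π) ∧
      ∀ π : Measure (ℝ × ℝ × ℝ), TollTransport.IsMinimizer μ ν r tf π →
        ∃ Tx Ty σ : ℝ → ℝ,
          AntitoneOn Tx (Icc 0 tf) ∧ AntitoneOn Ty (Icc 0 tf) ∧
          Measurable σ ∧ (∀ t ∈ Icc 0 tf, 0 ≤ σ t ∧ σ t ≤ r) ∧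
          π = ((volume.restrict (Icc 0 tf)).withDensity (fun t => ENNReal.ofReal (σ t))).map
            (fun t => (Tx t, Ty t, t)) := by
  -- Closed intervals suffice for the quantiles; openness serves only to give `μ {0} = 0`.
  have hμ' : μ (Icc (-M) 0)ᶜ = 0 :=
    measure_mono_null (compl_subset_compl.2 Ioo_subset_Icc_self) hμ
  have hν' : ν (Icc 0 M)ᶜ = 0 :=
    measure_mono_null (compl_subset_compl.2 Ioo_subset_Icc_self) hν
  have hμ0 : μ {0} = 0 := measure_mono_null (by simp) hμ
  obtain ⟨h1, h2⟩ :=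
    TollTransport.existsUnique_isMinimizer_and_eq_map hμ' hμ0 hν' hr htf hrtf
  refine ⟨h1, fun π hπ => ?_⟩
  have := hπ.1.isProbabilityMeasure_timeMarginal
  obtain ⟨σ, hσm, hσ, hρ⟩ :=
    TollTransport.exists_density_of_le (ρ := TollTransport.timeMarginal π) hr hπ.1.map_t_le
  refine ⟨_, _, σ, (TollTransport.antitone_position (ρ := TollTransport.timeMarginal π) hμ').antitoneOn _,
    (TollTransport.antitone_position (ρ := TollTransport.timeMarginal π) hν').antitoneOn _, hσm, fun t _ => hσ t, ?_⟩
  rw [← hρ]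
  exact h2 π hπ
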